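/- Let $\mathcal R$ be a skew field with an involution $*$ (an additive, anti-multiplicative map of order two), and let $\{m_i\}_{i\in\mathbb Z}\subset\mathcal R$ be moments. Let $z$ be a variable commuting with $\mathcal R$, put $(\sum_i a_iz^i)^*=\sum_i a_i^*z^{-i}$, and for $k\in\mathbb Z$ and polynomials define $$\Big\langle \sum_i a_iz^i,\sum_j b_jz^j\Big\rangle_k=\sum_{i,j}a_i\,m_{i-j+k}\,b_j^* .$$ Adjacent families of non-commutative Laurent bi-orthogonal polynomials are polynomials $P_n^{(k)},Q_n^{(k)}\in\mathcal R[z]$ ($k\in\mathbb Z$, $n\in\mathbb N=\{0,1,\dots\}$), monic of degree $n$, such that $\langle P_n^{(k)},Q_l^{(k)}\rangle_k=H_n^{(k)}\delta_{n,l}$ with invertible $H_n^{(k)}\in\mathcal R$. For a square matrix $A$, the quasi-determinant at position $(i,j)$ is $|A|_{i,j}=a_{i,j}-r_i^j(A^{i,j})^{-1}c_j^i$, where $A^{i,j}$ is $A$ without row $i$ and column $j$ (it is defined if $A^{i,j}$ is invertible), $r_i^j$ is the $i$-th row without its $j$-th entry and $c_j^i$ the $j$-th column without its $i$-th entry. Let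 $T_n^{(k)}=(m_{k+i-j})_{i,j=0}^n$ and $$\psi_n^{(k)}=\big(|T_n^{(k)}|_{n,n}\big)^{-1}|T_n^{(k-1)}|_{n,n},\qquad \varphi_n^{(k)}=\big(|T_n^{(k)}|_{0,n}\big)^{-1}|T_n^{(k-1)}|_{0,n}.$$ **Theorem.** Adjacent families exist if and only if all Toeplitz matrices $T_n^{(k)}$ ($k\in\mathbb Z$, $n\in\mathbb N$) are invertible. For any adjacent families: 1. The quasi-determinants $|T_n^{(k)}|_{n,n}$ and $|T_n^{(k)}|_{0,n}$ are defined and invertible, and $H_n^{(k)}=|T_n^{(k)}|_{n,n}$. 2. (Christoffel transformation) For $k\in\mathbb Z$, $n\in\mathbb N$, $c\in\mathcal R$: $(Q_{n+1}^{(k)})^*=z^{-1}(Q_n^{(k)})^*-(Q_n^{(k+1)})^*c$ holds if and only if $c=\varphi_n^{(k)}$. 3. (Geronimus transformation) For $k\in\mathbb Z$, $n\in\mathbb N$, $c\in\mathcal R$: $z^{-1}(Q_n^{(k-1)})^*=(Q_{n+1}^{(k)})^*+(Q_n^{(k)})^*c$ holds if and only if $c=\psi_n^{(k)}$. 4. (Three-term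 recurrence) For $k\in\mathbb Z$ and $n\in\mathbb N$, with $(Q_{-1}^{(k)})^*:=0$, $$z\big((Q_{n+1}^{(k)})^*+(Q_n^{(k)})^*\psi_n^{(k)}\big)=(Q_n^{(k)})^*+(Q_{n-1}^{(k)})^*\big(\psi_{n-1}^{(k)}-\varphi_{n-1}^{(k-1)}\big).$$ 5. (Discrete Lax equation) Put $\xi_i^{(k)}=\psi_i^{(k)}-\varphi_i^{(k-1)}$, $\Xi^{(k)}=\mathrm{diag}(\xi_0^{(k)},\xi_1^{(k)},\dots)$, $\Psi^{(k)}=\mathrm{diag}(\psi_0^{(k)},\psi_1^{(k)},\dots)$, $R^{(k)}=((Q_0^{(k)})^*,(Q_1^{(k)})^*,\dots)$, and let $\Lambda$ (resp. $\Lambda^{-1}$) be the semi-infinite matrix with ones just above (resp. below) the diagonal and zeros elsewhere. With $Y^{(k)}=\Psi^{(k)}+\Lambda^{-1}$ there are matrices $X^{(k)}$, with finitely many non-zero entries in each column, such that for all $k\in\mathbb Z$ $$X^{(k)}(I+\Xi^{(k)}\Lambda)=Y^{(k)},\quad z^{-1}R^{(k)}=R^{(k)}X^{(k)},\quad z^{-1}R^{(k-1)}=R^{(k)}Y^{(k)},\quad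 X^{(k)}Y^{(k)}=Y^{(k)}X^{(k-1)}.$$ 6. (Discrete non-commutative relativistic Toda equation) For $k\in\mathbb Z$, $$(\psi_i^{(k+1)}-\varphi_i^{(k)})\,\psi_{i+1}^{(k)}=\psi_i^{(k+1)}(\psi_i^{(k)}-\varphi_i^{(k-1)})\quad(i\ge 0),$$ $$\psi_i^{(k)}-\varphi_i^{(k)}=\psi_{i-1}^{(k)}-\varphi_{i-1}^{(k-1)}\quad(i\ge 1),\qquad \psi_0^{(k)}=\varphi_0^{(k)}.$$ 7. (Leapfrog map) For $k\in\mathbb Z$ and $i\ge 0$ put $a_i=\psi_i^{(k)}$, $b_i=\varphi_i^{(k-1)}-\psi_i^{(k)}$ and $a_i^+=\psi_i^{(k-1)}$, $b_i^+=\varphi_i^{(k-2)}-\psi_i^{(k-1)}$. Then $a_i$, $b_i$ and $a_i+b_i$ are non-zero for $i\ge0$, and these quantities satisfy the non-commutative leapfrog map in cross-ratio type coordinates, $$a_i^+=(a_{i-1}+b_{i-1})^{-1}a_{i-1}(a_i+b_i)\quad(i\ge 1),\qquad b_i^+=(a_i+b_i)^{-1}b_i(a_{i+1}+b_{i+1})\quad(i\ge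 0).$$ -/

import Mathlib

open scoped Polynomial LaurentPolynomial

namespace NCToda

section QuasiDeterminants

variable {R : Type*} [Ring R] {n : ℕ}

/-- The quasi-determinant of `A` at position `(i, j)` is defined when the submatrix obtained by
deleting row `i` and column `j` is invertible. -/
def QuasiDetDefined (A : Matrix (Fin (n + 1)) (Fin (n + 1)) R) (i j : Fin (n + 1)) : Prop :=
  IsUnit (A.submatrix i.succAbove j.succAbove)

/-- The quasi-determinant `|A|_{i,j} = a_{i,j} - r (A^{i,j})⁻¹ c`, where `r` is row `i` without its
`j`-th entry, `c` is column `j` without its `i`-th entry and `A^{i,j}` is `A` without row `i` and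
column `j`. (`Ring.inverse` is the two-sided inverse of a unit.) -/
noncomputable def quasiDet (A : Matrix (Fin (n + 1)) (Fin (n + 1)) R) (i j : Fin (n + 1)) : R :=
  A i j - ∑ p : Fin n, ∑ q : Fin n,
    A i (j.succAbove p) * Ring.inverse (A.submatrix i.succAbove j.succAbove) p q
      * A (i.succAbove q) j

end QuasiDeterminants

section Polynomials

variable {R : Type*} [DivisionRing R]

/-- The shifted Toeplitz matrix `(m_{k+i-j})`, `0 ≤ i, j ≤ n`. -/
def toeplitz (m : ℤ → R) (k : ℤ) (n : ℕ) : Matrix (Fin (n + 1)) (Fin (n + 1)) R :=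
  Matrix.of fun i j => m (k + (i : ℕ) - (j : ℕ))

/-- `ψ_n^{(k)}`: the quotient of the Toeplitz quasi-determinants boxed at the lower right corner. -/
noncomputable def psi (m : ℤ → R) (k : ℤ) (n : ℕ) : R :=
  (quasiDet (toeplitz m k n) (Fin.last n) (Fin.last n))⁻¹
    * quasiDet (toeplitz m (k - 1) n) (Fin.last n) (Fin.last n)

/-- `φ_n^{(k)}`: the quotient of the Toeplitz quasi-determinants boxed at the upper right corner. -/
noncomputable def phi (m : ℤ → R) (k : ℤ) (n : ℕ) : R :=
  (quasiDet (toeplitz m k n) 0 (Fin.last n))⁻¹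
    * quasiDet (toeplitz m (k - 1) n) 0 (Fin.last n)

variable [StarRing R]

/-- The involution `(∑ aᵢ zⁱ)^* = ∑ aᵢ^* z^{-i}`; the variable `z` is `LaurentPolynomial.T 1`. -/
noncomputable def starPoly (f : R[X]) : R[T;T⁻¹] :=
  f.sum fun i a => LaurentPolynomial.C (star a) * LaurentPolynomial.T (-(i : ℤ))

/-- `⟨∑ aᵢ zⁱ, ∑ bⱼ zʲ⟩_k = ∑ aᵢ m_{i-j+k} bⱼ^*`. -/
noncomputable def pairing (m : ℤ → R) (k : ℤ) (f g : R[X]) : R :=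
  f.sum fun i a => g.sum fun j b => a * m ((i : ℤ) - (j : ℤ) + k) * star b

/-- Adjacent families of non-commutative Laurent bi-orthogonal polynomials: `P_n^{(k)}` and
`Q_n^{(k)}` are monic of degree `n`, the `H_n^{(k)}` are invertible, and
`⟨P_n^{(k)}, Q_l^{(k)}⟩_k = H_n^{(k)} δ_{n,l}`. -/
structure IsAdjacent (m : ℤ → R) (P Q : ℤ → ℕ → R[X]) (H : ℤ → ℕ → R) : Prop where
  monic_left : ∀ k n, (P k n).Monic
  natDegree_left : ∀ k n, (P k n).natDegree = n
  monic_right : ∀ k n, (Q k n).Monic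
  natDegree_right : ∀ k n, (Q k n).natDegree = n
  isUnit_norm : ∀ k n, IsUnit (H k n)
  orthogonal : ∀ k n l, pairing m k (P k n) (Q k l) = if n = l then H k n else 0

end Polynomials

section Lax

variable {R : Type*} [DivisionRing R]

/-- Semi-infinite matrices with finitely many non-zero entries in each column: the entry in row `i`
and column `n` of `M` is `M n i`. -/
abbrev ColMatrix (R : Type*) [Zero R] := ℕ → (ℕ →₀ R)

/-- The matrix product, `(M N)_{i,n} = ∑ⱼ M_{i,j} N_{j,n}`. -/
noncomputable def colMul (M N : ColMatrix R) : ColMatrix R := fun n =>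
  (N n).sum fun j c => (M j).mapRange (fun x => x * c) (zero_mul c)

/-- The product of a row of Laurent polynomials with a matrix, coefficients acting on the right:
`(r M)_n = ∑ⱼ rⱼ M_{j,n}`. -/
noncomputable def rowMul (r : ℕ → R[T;T⁻¹]) (M : ColMatrix R) : ℕ → R[T;T⁻¹] := fun n =>
  (M n).sum fun j c => r j * LaurentPolynomial.C c

/-- `diag(c₀, c₁, …) + Λ⁻¹`, where `Λ⁻¹` has the entries `1` just below the diagonal. -/
noncomputable def lowerBidiag (c : ℕ → R) : ColMatrix R := fun n =>
  Finsupp.single n (c n) + Finsupp.single (n + 1) 1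

/-- `I + diag(c₀, c₁, …) Λ`, where `Λ` has the entries `1` just above the diagonal. -/
noncomputable def upperBidiag (c : ℕ → R) : ColMatrix R
  | 0 => Finsupp.single 0 1
  | n + 1 => Finsupp.single (n + 1) 1 + Finsupp.single n (c n)

/-- The non-commutative leapfrog map in cross-ratio type coordinates,
`aᵢ⁺ = (aᵢ₋₁ + bᵢ₋₁)⁻¹ aᵢ₋₁ (aᵢ + bᵢ)`, `bᵢ⁺ = (aᵢ + bᵢ)⁻¹ bᵢ (aᵢ₊₁ + bᵢ₊₁)`. -/
def leapfrogMap (ab : (ℤ → R) × (ℤ → R)) : (ℤ → R) × (ℤ → R) :=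
  (fun i => (ab.1 (i - 1) + ab.2 (i - 1))⁻¹ * ab.1 (i - 1) * (ab.1 i + ab.2 i),
   fun i => (ab.1 i + ab.2 i)⁻¹ * ab.2 i * (ab.1 (i + 1) + ab.2 (i + 1)))

end Lax

end NCToda

/-! Everything is carried by right-linear moment functionals. Writing the pairing as `∑ aᵢ
L_{k+i}(Q^*)`, where `L_s` sends `zᵉ a` to `m_{s+e} a`, bi-orthogonality says that `L_{k+i}` kills
`(Q_n^{(k)})^*` for `0 ≤ i < n` and takes the value `H_n^{(k)}` at `i = n`. An invertible
`T_n^{(k)}` means that an element of the span of `1, …, z⁻ⁿ` with vanishing moments `k, …, k + n` is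
zero (`SpannedBy.eq_zero`). Each of the two transformations is proved by cancelling leading terms
and comparing these `n + 1` moments; the one moment that does not vanish trivially fixes the
coefficient as a ratio of quasi-determinants.

Let `Y^{(k)} = Ψ^{(k)} + Λ⁻¹` and `U^{(k)} = I + Ξ^{(k)} Λ`. Geronimus reads `R^{(k)} Y^{(k)} = z⁻¹
R^{(k-1)}`, and combined with Christoffel it gives `R^{(k)} U^{(k)} = R^{(k-1)}`. The entries of
`R^{(k)}` are right linearly independent, so identities between matrices may be tested on this row:
this yields the Lax equation and `Y^{(k+1)} U^{(k)} = U^{(k+1)} Y^{(k)}`, whose entries are the Toda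
equation. The leapfrog map follows from the Toda equation, since `aᵢ + bᵢ = φ_i^{(k-1)}`. -/

namespace NCToda

/-! ### Quasi-determinants and linear systems over a ring -/

section Matrices

variable {R : Type*} [Ring R] {n : ℕ}

/-- A vector with entry `1` at `j` on which every row of `A` but the `i`-th vanishes has the
quasi-determinant at `(i, j)` as its product with the `i`-th row. -/
theorem mulVec_eq_quasiDet {A : Matrix (Fin (n + 1)) (Fin (n + 1)) R} {i j : Fin (n + 1)}
    (hA : QuasiDetDefined A i j) {v : Fin (n + 1) → R} (hv : v j = 1)
    (h : ∀ p, (A.mulVec v) (i.succAbove p) = 0) : (A.mulVec v) i = quasiDet A i j := by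
  set S := A.submatrix i.succAbove j.succAbove with hS
  set w : Fin n → R := fun p => v (j.succAbove p) with hw
  have expand : ∀ p, (A.mulVec v) p = A p j + ∑ q, A p (j.succAbove q) * w q := fun p => by
    simp [Matrix.mulVec, dotProduct, Fin.sum_univ_succAbove _ j, hv, hw]
  have hSw : S.mulVec w = fun q => -A (i.succAbove q) j := by
    funext q
    have := h q
    rw [expand] at this
    simpa [Matrix.mulVec, dotProduct, hS] using eq_neg_of_add_eq_zero_right this
  have hw' : w = (Ring.inverse S).mulVec fun q => -A (i.succAbove q) j := by
    rw [← hSw, Matrix.mulVec_mulVec, Ring.inverse_mul_cancel _ hA, Matrix.one_mulVec]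
  rw [expand, quasiDet, sub_eq_add_neg, ← Finset.sum_neg_distrib]
  congr 1
  refine Finset.sum_congr rfl fun p _ => ?_
  rw [hw']
  simp [Matrix.mulVec, dotProduct, Finset.mul_sum, mul_assoc, hS]

/-- A vector with entry `1` at `j` on which every row of `A` but the `i`-th vanishes. -/
theorem exists_mulVec_succAbove_eq_zero {A : Matrix (Fin (n + 1)) (Fin (n + 1)) R}
    {i j : Fin (n + 1)} (hA : QuasiDetDefined A i j) :
    ∃ v : Fin (n + 1) → R, v j = 1 ∧ ∀ p, (A.mulVec v) (i.succAbove p) = 0 := by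
  set S := A.submatrix i.succAbove j.succAbove with hS
  set w := (Ring.inverse S).mulVec fun q => -A (i.succAbove q) j with hw
  have hSw : S.mulVec w = fun q => -A (i.succAbove q) j := by
    rw [hw, Matrix.mulVec_mulVec, Ring.mul_inverse_cancel _ hA, Matrix.one_mulVec]
  refine ⟨j.insertNth (1 : R) w, by simp, fun p => ?_⟩
  have := congrFun hSw p
  simp only [Matrix.mulVec, dotProduct, hS, Matrix.submatrix_apply] at this
  simp [Matrix.mulVec, dotProduct, Fin.sum_univ_succAbove _ j, this]

/-- A vector with entry `1` at `i` annihilating every column of `A` but the `j`-th. -/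
theorem exists_vecMul_succAbove_eq_zero {A : Matrix (Fin (n + 1)) (Fin (n + 1)) R}
    {i j : Fin (n + 1)} (hA : QuasiDetDefined A i j) :
    ∃ u : Fin (n + 1) → R, u i = 1 ∧ ∀ q, (Matrix.vecMul u A) (j.succAbove q) = 0 := by
  set S := A.submatrix i.succAbove j.succAbove with hS
  set w := Matrix.vecMul (fun q => -A i (j.succAbove q)) (Ring.inverse S) with hw
  have hSw : Matrix.vecMul w S = fun q => -A i (j.succAbove q) := by
    rw [hw, Matrix.vecMul_vecMul, Ring.inverse_mul_cancel _ hA, Matrix.vecMul_one]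
  refine ⟨i.insertNth (1 : R) w, by simp, fun p => ?_⟩
  have := congrFun hSw p
  simp only [Matrix.vecMul, dotProduct, hS, Matrix.submatrix_apply] at this
  simp [Matrix.vecMul, dotProduct, Fin.sum_univ_succAbove _ i, this]

theorem mulVec_injective_of_isUnit {ι : Type*} [Fintype ι] [DecidableEq ι] {A : Matrix ι ι R}
    (hA : IsUnit A) {v : ι → R} (h : A.mulVec v = 0) : v = 0 := by
  rw [← Matrix.one_mulVec v, ← Ring.inverse_mul_cancel _ hA, ← Matrix.mulVec_mulVec, h,
    Matrix.mulVec_zero]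

end Matrices

/-! ### Minors of Toeplitz matrices -/

section Toeplitz

variable {R : Type*} (m : ℤ → R)

theorem toeplitz_submatrix_last (k : ℤ) (n : ℕ) :
    (toeplitz m k (n + 1)).submatrix (Fin.last (n + 1)).succAbove (Fin.last (n + 1)).succAbove =
      toeplitz m k n := by
  ext i j
  simp [toeplitz]

/-- Dropping the top row raises every row index by one, which for a Toeplitz matrix is a shift of
`k`. -/
theorem toeplitz_submatrix_zero_last (k : ℤ) (n : ℕ) :
    (toeplitz m k (n + 1)).submatrix (0 : Fin (n + 2)).succAbove (Fin.last (n + 1)).succAbove =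
      toeplitz m (k + 1) n := by
  ext i j
  simp only [toeplitz, Matrix.submatrix_apply, Matrix.of_apply]
  congr 1
  simp
  ring

variable [DivisionRing R] {m}

theorem quasiDetDefined_last (hT : ∀ k n, IsUnit (toeplitz m k n)) (k : ℤ) :
    ∀ n, QuasiDetDefined (toeplitz m k n) (Fin.last n) (Fin.last n)
  | 0 => isUnit_of_subsingleton _
  | n + 1 => by
    rw [QuasiDetDefined, toeplitz_submatrix_last]
    exact hT k n

theorem quasiDetDefined_zero_last (hT : ∀ k n, IsUnit (toeplitz m k n)) (k : ℤ) :
    ∀ n, QuasiDetDefined (toeplitz m k n) 0 (Fin.last n)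
  | 0 => isUnit_of_subsingleton _
  | n + 1 => by
    rw [QuasiDetDefined, toeplitz_submatrix_zero_last]
    exact hT (k + 1) n

end Toeplitz

/-! ### Moment functionals on Laurent polynomials -/

section Moments

open LaurentPolynomial

variable {R : Type*} [DivisionRing R]

/-- The functional `∑ aₑ zᵉ ↦ ∑ m_{s+e} aₑ`, linear over the right multiplications. -/
noncomputable def momentFun (m : ℤ → R) (s : ℤ) : R[T;T⁻¹] →+ R :=
  (Finsupp.liftAddHom fun e => AddMonoidHom.mulLeft (m (s + e))).comp
    (AddMonoidAlgebra.coeffAddEquiv (R := R) (M := ℤ)).toAddMonoidHom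

/-- The Laurent polynomials in the span of `1, z⁻¹, …, z⁻ⁿ`. -/
def SpannedBy (n : ℕ) (F : R[T;T⁻¹]) : Prop :=
  ∀ e : ℤ, e < -(n : ℤ) ∨ 0 < e → F.coeff e = 0

theorem coeff_mul_C (F : R[T;T⁻¹]) (c : R) (e : ℤ) : (F * C c).coeff e = F.coeff e * c := by
  rw [← single_eq_C, AddMonoidAlgebra.coeff_mul_single_zero]

/-- Gives the uniqueness of the coefficients in the Christoffel and Geronimus transformations. -/
theorem mul_C_cancel {F : R[T;T⁻¹]} (hF : F ≠ 0) {c d : R} (hcd : F * C c = F * C d) : c = d := by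
  obtain ⟨e, he⟩ : ∃ e, F.coeff e ≠ 0 := by
    by_contra! h0
    exact hF (LaurentPolynomial.ext fun a => by simp [h0])
  have := congrArg (fun G : R[T;T⁻¹] => G.coeff e) hcd
  simp only [coeff_mul_C] at this
  exact mul_left_cancel₀ he this

theorem coeff_T_mul (s : ℤ) (F : R[T;T⁻¹]) (e : ℤ) : (T s * F).coeff e = F.coeff (e - s) := by
  induction F using AddMonoidAlgebra.induction_linear with
  | zero => simp
  | add f g hf hg => rw [mul_add, AddMonoidAlgebra.coeff_add, Finsupp.add_apply, hf, hg]; rfl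
  | single a b =>
    simp only [T, AddMonoidAlgebra.single_mul_single, AddMonoidAlgebra.coeff_single,
      Finsupp.single_apply, one_mul]
    congr 1
    exact propext ⟨fun h => by omega, fun h => by omega⟩

variable (m : ℤ → R)

theorem momentFun_single (s e : ℤ) (a : R) :
    momentFun m s (AddMonoidAlgebra.single e a) = m (s + e) * a :=
  Finsupp.sum_single_index (mul_zero _)

theorem momentFun_mul_C (s : ℤ) (F : R[T;T⁻¹]) (c : R) :
    momentFun m s (F * C c) = momentFun m s F * c := by
  induction F using AddMonoidAlgebra.induction_linear with
  | zero => simp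
  | add f g hf hg => simp [add_mul, hf, hg]
  | single a b =>
    rw [← single_eq_C, AddMonoidAlgebra.single_mul_single, momentFun_single, momentFun_single]
    simp [mul_assoc]

theorem momentFun_T_mul (s t : ℤ) (F : R[T;T⁻¹]) :
    momentFun m s (T t * F) = momentFun m (s + t) F := by
  induction F using AddMonoidAlgebra.induction_linear with
  | zero => simp
  | add f g hf hg => rw [mul_add, map_add, map_add, hf, hg]
  | single a b =>
    rw [T, AddMonoidAlgebra.single_mul_single, momentFun_single, momentFun_single]
    simp [add_assoc]

variable {m}

theorem SpannedBy.eq_sum {n : ℕ} {F : R[T;T⁻¹]} (hF : SpannedBy n F) :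
    F = ∑ j : Fin (n + 1), AddMonoidAlgebra.single (-(j : ℤ)) (F.coeff (-(j : ℤ))) := by
  ext e
  rw [AddMonoidAlgebra.coeff_sum, Finsupp.finsetSum_apply]
  simp only [AddMonoidAlgebra.coeff_single, Finsupp.single_apply]
  by_cases he : e < -(n : ℤ) ∨ 0 < e
  · rw [hF e he, Finset.sum_eq_zero]
    intro j _
    rw [if_neg]
    have := j.2
    omega
  · rw [Finset.sum_eq_single (⟨(-e).toNat, by omega⟩ : Fin (n + 1))]
    · have : (-((-e).toNat : ℤ)) = e := by omega
      rw [this, if_pos rfl]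
    · intro j _ hj
      rw [if_neg]
      intro h
      exact hj (Fin.ext (by simp; omega))
    · simp

theorem SpannedBy.sub {n : ℕ} {F G : R[T;T⁻¹]} (hF : SpannedBy n F) (hG : SpannedBy n G) :
    SpannedBy n (F - G) := fun e he => by
  simp [AddMonoidAlgebra.coeff_sub, hF e he, hG e he]

theorem SpannedBy.mul_C {n : ℕ} {F : R[T;T⁻¹]} (hF : SpannedBy n F) (c : R) :
    SpannedBy n (F * C c) := fun e he => by
  rw [coeff_mul_C, hF e he, zero_mul]

/-- The entries of `T_n^{(k)} v` are moments of the Laurent polynomial with coefficients `v`. -/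
theorem SpannedBy.toeplitz_mulVec {n : ℕ} {F : R[T;T⁻¹]} (hF : SpannedBy n F) (k : ℤ)
    (i : Fin (n + 1)) :
    (toeplitz m k n).mulVec (fun j => F.coeff (-(j : ℤ))) i = momentFun m (k + i) F := by
  conv_rhs => rw [hF.eq_sum]
  rw [map_sum]
  simp only [momentFun_single]
  simp [Matrix.mulVec, dotProduct, toeplitz, sub_eq_add_neg]

/-- The moments are the entries of `T_n^{(k)}` applied to the coefficient vector, so invertibility
makes that vector zero. This is the uniqueness principle behind all the recurrences. -/
theorem SpannedBy.eq_zero {n : ℕ} {F : R[T;T⁻¹]} (hF : SpannedBy n F) {k : ℤ}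
    (hT : IsUnit (toeplitz m k n)) (h : ∀ i : ℕ, i ≤ n → momentFun m (k + i) F = 0) : F = 0 := by
  have hv : (fun j : Fin (n + 1) => F.coeff (-(j : ℤ))) = 0 :=
    mulVec_injective_of_isUnit hT (funext fun i => by
      rw [hF.toeplitz_mulVec]; exact h i (by omega))
  rw [hF.eq_sum]
  refine Finset.sum_eq_zero fun j _ => ?_
  have := congrFun hv j
  simp only [Pi.zero_apply] at this
  rw [this, AddMonoidAlgebra.single_zero]

end Moments

/-! ### The pairing expressed by moments and Toeplitz matrices -/

section StarPoly

open LaurentPolynomial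

variable {R : Type*} [DivisionRing R] [StarRing R]

theorem coeff_starPoly (f : R[X]) (e : ℤ) :
    (starPoly f).coeff e = if e ≤ 0 then star (f.coeff (-e).toNat) else 0 := by
  have : starPoly f = f.sum fun i a => AddMonoidAlgebra.single (-(i : ℤ)) (star a) := by
    simp only [starPoly, single_eq_C_mul_T]
  rw [this, Polynomial.sum_def, AddMonoidAlgebra.coeff_sum, Finsupp.finsetSum_apply]
  simp only [AddMonoidAlgebra.coeff_single, Finsupp.single_apply]
  split_ifs with he
  · rw [Finset.sum_eq_single (-e).toNat]
    · rw [if_pos (by omega)]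
    · intro b _ hb
      rw [if_neg (by omega)]
    · intro h
      simp [Polynomial.notMem_support_iff.1 h]
  · exact Finset.sum_eq_zero fun b _ => if_neg (by omega)

theorem spannedBy_starPoly {f : R[X]} {n : ℕ} (hf : f.natDegree ≤ n) : SpannedBy n (starPoly f) := by
  intro e he
  rw [coeff_starPoly]
  split_ifs with h
  · rw [Polynomial.coeff_eq_zero_of_natDegree_lt (by omega), star_zero]
  · rfl

theorem coeff_starPoly_neg (f : R[X]) (j : ℕ) :
    (starPoly f).coeff (-(j : ℤ)) = star (f.coeff j) := by
  rw [coeff_starPoly, if_pos (by omega)]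
  simp

theorem pairing_eq_sum (m : ℤ → R) (k : ℤ) (f g : R[X]) :
    pairing m k f g = f.sum fun i a => a * momentFun m (k + i) (starPoly g) := by
  unfold pairing
  congr 1
  funext i a
  simp only [starPoly, ← single_eq_C_mul_T, Polynomial.sum_def, map_sum, momentFun_single,
    Finset.mul_sum]
  refine Finset.sum_congr rfl fun j _ => ?_
  rw [mul_assoc]
  congr 3
  ring

theorem pairing_eq_sum_range (m : ℤ → R) (k : ℤ) {f : R[X]} (g : R[X]) {n : ℕ}
    (hf : f.natDegree ≤ n) :
    pairing m k f g =
      ∑ i ∈ Finset.range (n + 1), f.coeff i * momentFun m (k + i) (starPoly g) := by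
  rw [pairing_eq_sum, Polynomial.sum_over_range' _ (by simp) (n + 1) (by omega)]

/-- The pairing of two polynomials of degree at most `n` in terms of the Toeplitz matrix. -/
theorem pairing_eq_dotProduct (m : ℤ → R) (k : ℤ) {f g : R[X]} {n : ℕ}
    (hf : f.natDegree ≤ n) (hg : g.natDegree ≤ n) :
    pairing m k f g = dotProduct (fun i : Fin (n + 1) => f.coeff i)
      ((toeplitz m k n).mulVec fun j => star (g.coeff j)) := by
  rw [pairing_eq_sum_range m k g hf, ← Fin.sum_univ_eq_sum_range
    (fun i => f.coeff i * momentFun m (k + i) (starPoly g))]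
  refine Finset.sum_congr rfl fun i _ => ?_
  rw [← (spannedBy_starPoly hg).toeplitz_mulVec]
  simp only [coeff_starPoly_neg]

end StarPoly

/-! ### Construction of adjacent families -/

section Existence

variable {R : Type*} [DivisionRing R]

/-- The monic polynomial `Xⁿ + ∑_{i<n} vᵢ Xⁱ`. -/
noncomputable def monicOfCoeffs (n : ℕ) (v : Fin (n + 1) → R) : R[X] :=
  Polynomial.X ^ n + ∑ i : Fin n, Polynomial.C (v i.castSucc) * Polynomial.X ^ (i : ℕ)

theorem degree_sum_lt (n : ℕ) (v : Fin (n + 1) → R) :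
    (∑ i : Fin n, Polynomial.C (v i.castSucc) * Polynomial.X ^ (i : ℕ)).degree <
      (n : WithBot ℕ) := by
  refine lt_of_le_of_lt (Polynomial.degree_sum_le _ _)
    ((Finset.sup_lt_iff (WithBot.bot_lt_coe n)).2 ?_)
  intro i _
  exact lt_of_le_of_lt (Polynomial.degree_C_mul_X_pow_le _ _) (WithBot.coe_lt_coe.2 i.2)

theorem monic_monicOfCoeffs (n : ℕ) (v : Fin (n + 1) → R) : (monicOfCoeffs n v).Monic :=
  Polynomial.monic_X_pow_add (degree_sum_lt n v)

theorem natDegree_monicOfCoeffs (n : ℕ) (v : Fin (n + 1) → R) :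
    (monicOfCoeffs n v).natDegree = n := by
  rw [monicOfCoeffs, add_comm]
  exact Polynomial.natDegree_add_eq_right_of_degree_lt
    (by simpa using degree_sum_lt n v) |>.trans (Polynomial.natDegree_X_pow n)

theorem coeff_monicOfCoeffs {n : ℕ} {v : Fin (n + 1) → R} (hv : v (Fin.last n) = 1)
    (i : Fin (n + 1)) : (monicOfCoeffs n v).coeff i = v i := by
  simp only [monicOfCoeffs, Polynomial.coeff_add, Polynomial.coeff_X_pow,
    Polynomial.finsetSum_coeff, Polynomial.coeff_C_mul]
  induction i using Fin.lastCases with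
  | last =>
    rw [Finset.sum_eq_zero fun j _ => ?_]
    · simp [hv]
    · rw [if_neg (by have := j.2; simp; omega), mul_zero]
  | cast i =>
    rw [Finset.sum_eq_single i]
    · simp [i.2.ne]
    · intro j _ hj
      rw [if_neg (by simpa using fun h => hj (Fin.ext h.symm)), mul_zero]
    · simp

variable {m : ℤ → R}

theorem sum_mul_eq_last {n : ℕ} {u w : Fin (n + 1) → R}
    (h : ∀ i : Fin n, u i.castSucc * w i.castSucc = 0) :
    ∑ i, u i * w i = u (Fin.last n) * w (Fin.last n) := by
  rw [Fin.sum_univ_castSucc, Finset.sum_eq_zero fun i _ => h i, zero_add]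

variable [StarRing R]

/-- The coefficients of `P_n` and `Q_n` solve the row and column systems of `T_n^{(k)}` with last
entry `1`. For unequal degrees, take the matrix of the larger size: all terms but the last vanish by
the system, and the last by the degree of the other polynomial. -/
theorem exists_isAdjacent (hT : ∀ k n, IsUnit (toeplitz m k n)) :
    ∃ P Q H, IsAdjacent m P Q H := by
  choose v hv1 hv using fun k n => exists_mulVec_succAbove_eq_zero (quasiDetDefined_last hT k n)
  choose u hu1 hu using fun k n => exists_vecMul_succAbove_eq_zero (quasiDetDefined_last hT k n)
  simp only [Fin.succAbove_last] at hv hu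
  set P : ℤ → ℕ → R[X] := fun k n => monicOfCoeffs n (u k n) with hP
  -- The pairing conjugates the coefficients of its second argument, so they are conjugated here
  -- beforehand.
  set Q : ℤ → ℕ → R[X] := fun k n => monicOfCoeffs n fun i => star (v k n i) with hQ
  have hPd : ∀ k n, (P k n).natDegree = n := fun k n => natDegree_monicOfCoeffs _ _
  have hQd : ∀ k n, (Q k n).natDegree = n := fun k n => natDegree_monicOfCoeffs _ _
  have hPc : ∀ k n (i : Fin (n + 1)), (P k n).coeff i = u k n i := fun k n i =>
    coeff_monicOfCoeffs (hu1 k n) i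
  have hQc : ∀ k n (i : Fin (n + 1)), star ((Q k n).coeff i) = v k n i := fun k n i => by
    rw [hQ]
    simp only
    rw [coeff_monicOfCoeffs (v := fun i => star (v k n i)) (by rw [hv1, star_one]), star_star]
  have hPm : ∀ k n, (P k n).Monic := fun k n => monic_monicOfCoeffs _ _
  have hQm : ∀ k n, (Q k n).Monic := fun k n => monic_monicOfCoeffs _ _
  refine ⟨P, Q, fun k n => (toeplitz m k n).mulVec (v k n) (Fin.last n), ⟨hPm, hPd, hQm, hQd,
    fun k n => ?_, fun k n l => ?_⟩⟩
  · rw [isUnit_iff_ne_zero]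
    intro h0
    -- A zero norm would put `v`, whose last entry is `1`, into the kernel of the Toeplitz matrix.
    have : v k n = 0 := mulVec_injective_of_isUnit (hT k n) (funext fun i => by
      induction i using Fin.lastCases with
      | last => exact h0
      | cast i => exact hv k n i)
    have := congrFun this (Fin.last n)
    rw [hv1] at this
    exact one_ne_zero this
  · rcases lt_trichotomy n l with h | rfl | h
    · rw [if_neg h.ne, pairing_eq_dotProduct m k ((hPd k n).trans_le h.le) (hQd k l).le]
      simp only [hQc, dotProduct]
      rw [sum_mul_eq_last fun i => by rw [hv, mul_zero], Fin.val_last,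
        Polynomial.coeff_eq_zero_of_natDegree_lt (by rw [hPd]; exact h), zero_mul]
    · rw [if_pos rfl, pairing_eq_dotProduct m k (hPd k n).le (hQd k n).le]
      simp only [hQc, dotProduct]
      rw [sum_mul_eq_last fun i => by rw [hv, mul_zero], hPc, hu1, one_mul]
    · rw [if_neg h.ne', pairing_eq_dotProduct m k (hPd k n).le ((hQd k l).trans_le h.le),
        Matrix.dotProduct_mulVec]
      simp only [hPc, dotProduct]
      rw [sum_mul_eq_last fun i => by rw [hu, zero_mul], Fin.val_last,
        Polynomial.coeff_eq_zero_of_natDegree_lt (by rw [hQd]; exact h), star_zero, mul_zero]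

end Existence

/-! ### Moments of adjacent families and the spectral transformations -/

namespace IsAdjacent

open LaurentPolynomial

variable {R : Type*} [DivisionRing R] [StarRing R] {m : ℤ → R} {P Q : ℤ → ℕ → R[X]}
  {H : ℤ → ℕ → R}

/-- Orthogonality is a factorization `A T B = diag(H)` with the coefficient matrices of `P` and
`Q^*`. -/
theorem isUnit_toeplitz (h : IsAdjacent m P Q H) (k : ℤ) (n : ℕ) : IsUnit (toeplitz m k n) := by
  set A : Matrix (Fin (n + 1)) (Fin (n + 1)) R := Matrix.of fun i a => (P k i).coeff a with hA
  set B : Matrix (Fin (n + 1)) (Fin (n + 1)) R := Matrix.of fun b j => star ((Q k j).coeff b) with hB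
  have key : A * (toeplitz m k n * B) = Matrix.diagonal fun i : Fin (n + 1) => H k i := by
    ext i j
    have hp : pairing m k (P k i) (Q k j) = (A * (toeplitz m k n * B)) i j := by
      rw [pairing_eq_dotProduct m k (n := n) (by rw [h.natDegree_left]; omega)
        (by rw [h.natDegree_right]; omega)]
      rfl
    rw [← hp, h.orthogonal, Matrix.diagonal_apply]
    simp only [Fin.ext_iff]
  set D : Matrix (Fin (n + 1)) (Fin (n + 1)) R := Matrix.diagonal fun i => (H k i)⁻¹ with hD
  have hone : A * (toeplitz m k n * (B * D)) = 1 := by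
    rw [← Matrix.mul_assoc (toeplitz m k n), ← Matrix.mul_assoc, key, hD,
      Matrix.diagonal_mul_diagonal, ← Matrix.diagonal_one]
    congr 1
    funext i
    exact mul_inv_cancel₀ (h.isUnit_norm k i).ne_zero
  -- One-sided inverses of square matrices over a skew field are two-sided; this moves `A` to the
  -- right and then makes the right inverse of `T` an inverse.
  rw [mul_eq_one_comm, Matrix.mul_assoc] at hone
  exact IsUnit.of_mul_eq_one _ hone

theorem spannedBy (h : IsAdjacent m P Q H) (k : ℤ) (n : ℕ) : SpannedBy n (starPoly (Q k n)) :=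
  spannedBy_starPoly (h.natDegree_right k n).le

theorem coeff_starPoly_lead (h : IsAdjacent m P Q H) (k : ℤ) (n : ℕ) :
    (starPoly (Q k n)).coeff (-(n : ℤ)) = 1 := by
  rw [coeff_starPoly_neg]
  have := (h.monic_right k n).coeff_natDegree
  rw [h.natDegree_right] at this
  rw [this, star_one]

theorem starPoly_zero (h : IsAdjacent m P Q H) (k : ℤ) : starPoly (Q k 0) = 1 := by
  rw [(h.spannedBy k 0).eq_sum]
  have := h.coeff_starPoly_lead k 0
  simp only [Nat.cast_zero, neg_zero] at this
  simp [this]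

theorem starPoly_ne_zero (h : IsAdjacent m P Q H) (k : ℤ) (n : ℕ) : starPoly (Q k n) ≠ 0 := by
  intro h0
  have := h.coeff_starPoly_lead k n
  rw [h0] at this
  simp at this

/-- In the pairing with the monic `P_i`, the moments below `i` vanish by induction, which isolates
the `i`-th one. -/
theorem momentFun_of_lt (h : IsAdjacent m P Q H) (k : ℤ) (n : ℕ) (i : ℕ) (hi : i < n) :
    momentFun m (k + i) (starPoly (Q k n)) = 0 := by
  induction i using Nat.strong_induction_on with
  | _ i ih =>
    have hp := h.orthogonal k i n
    rw [if_neg hi.ne, pairing_eq_sum_range m k _ (h.natDegree_left k i).le,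
      Finset.sum_range_succ, Finset.sum_eq_zero fun j hj => by
        rw [ih j (Finset.mem_range.1 hj) ((Finset.mem_range.1 hj).trans hi), mul_zero]] at hp
    have hl := (h.monic_left k i).coeff_natDegree
    rw [h.natDegree_left] at hl
    simpa [hl] using hp

theorem momentFun_self (h : IsAdjacent m P Q H) (k : ℤ) (n : ℕ) :
    momentFun m (k + n) (starPoly (Q k n)) = H k n := by
  have hp := h.orthogonal k n n
  rw [if_pos rfl, pairing_eq_sum_range m k _ (h.natDegree_left k n).le,
    Finset.sum_range_succ, Finset.sum_eq_zero fun j hj => by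
      rw [h.momentFun_of_lt k n j (Finset.mem_range.1 hj), mul_zero]] at hp
  have hl := (h.monic_left k n).coeff_natDegree
  rw [h.natDegree_left] at hl
  simpa [hl] using hp

/-- The moment just below the orthogonality range does not vanish. -/
theorem momentFun_pred_ne_zero (h : IsAdjacent m P Q H) (k : ℤ) (n : ℕ) :
    momentFun m (k - 1) (starPoly (Q k n)) ≠ 0 := by
  intro h0
  -- With the `n` moments killed by orthogonality this would make `n + 1` consecutive zeros,
  -- starting at `k - 1`.
  refine h.starPoly_ne_zero k n ((h.spannedBy k n).eq_zero (h.isUnit_toeplitz (k - 1) n) ?_)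
  rintro (_ | i) hi
  · simpa using h0
  · have := h.momentFun_of_lt k n i (by omega)
    rwa [show k - 1 + ((i + 1 : ℕ) : ℤ) = k + i by push_cast; ring]

theorem eq_quasiDet_last (h : IsAdjacent m P Q H) (k : ℤ) (n : ℕ) :
    H k n = quasiDet (toeplitz m k n) (Fin.last n) (Fin.last n) := by
  rw [← mulVec_eq_quasiDet (quasiDetDefined_last h.isUnit_toeplitz k n)
    (v := fun j : Fin (n + 1) => (starPoly (Q k n)).coeff (-(j : ℤ))) (h.coeff_starPoly_lead k n)]
  · rw [(h.spannedBy k n).toeplitz_mulVec, Fin.val_last, h.momentFun_self]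
  · intro p
    rw [(h.spannedBy k n).toeplitz_mulVec]
    exact h.momentFun_of_lt k n _ (by simp)

/-- The level is `k + 1` because `(Q_n^{(k+1)})^*` has vanishing moments `k + 1, …, k + n`: these
are all rows of `T_n^{(k)}` but the top one. -/
theorem momentFun_pred_eq_quasiDet (h : IsAdjacent m P Q H) (k : ℤ) (n : ℕ) :
    momentFun m k (starPoly (Q (k + 1) n)) = quasiDet (toeplitz m k n) 0 (Fin.last n) := by
  rw [← mulVec_eq_quasiDet (quasiDetDefined_zero_last h.isUnit_toeplitz k n)
    (v := fun j : Fin (n + 1) => (starPoly (Q (k + 1) n)).coeff (-(j : ℤ)))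
    (h.coeff_starPoly_lead (k + 1) n)]
  · rw [(h.spannedBy _ n).toeplitz_mulVec]
    simp
  · intro p
    rw [(h.spannedBy _ n).toeplitz_mulVec, ← h.momentFun_of_lt (k + 1) n p p.2]
    congr 1
    simp
    ring_nf

theorem psi_eq (h : IsAdjacent m P Q H) (k : ℤ) (n : ℕ) : psi m k n = (H k n)⁻¹ * H (k - 1) n := by
  rw [psi, h.eq_quasiDet_last, h.eq_quasiDet_last]

theorem phi_eq (h : IsAdjacent m P Q H) (k : ℤ) (n : ℕ) :
    phi m k n = (momentFun m k (starPoly (Q (k + 1) n)))⁻¹ *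
      momentFun m (k - 1) (starPoly (Q k n)) := by
  have := h.momentFun_pred_eq_quasiDet (k - 1) n
  rw [sub_add_cancel] at this
  rw [phi, h.momentFun_pred_eq_quasiDet, this]

theorem psi_ne_zero (h : IsAdjacent m P Q H) (k : ℤ) (n : ℕ) : psi m k n ≠ 0 := by
  rw [h.psi_eq]
  exact mul_ne_zero (inv_ne_zero (h.isUnit_norm k n).ne_zero) (h.isUnit_norm _ n).ne_zero

theorem momentFun_succ_ne_zero (h : IsAdjacent m P Q H) (k : ℤ) (n : ℕ) :
    momentFun m k (starPoly (Q (k + 1) n)) ≠ 0 := by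
  simpa using h.momentFun_pred_ne_zero (k + 1) n

theorem phi_ne_zero (h : IsAdjacent m P Q H) (k : ℤ) (n : ℕ) : phi m k n ≠ 0 := by
  rw [h.phi_eq]
  exact mul_ne_zero (inv_ne_zero (h.momentFun_succ_ne_zero k n)) (h.momentFun_pred_ne_zero k n)

/-- The difference of two members with shifted leading terms is of lower degree. -/
theorem spannedBy_T_mul_sub (h : IsAdjacent m P Q H) (k l : ℤ) (n : ℕ) :
    SpannedBy n (T (-1) * starPoly (Q l n) - starPoly (Q k (n + 1))) := by
  intro e he
  rw [AddMonoidAlgebra.coeff_sub, Finsupp.sub_apply, coeff_T_mul]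
  rcases he with he | he
  · by_cases h1 : e = -((n + 1 : ℕ) : ℤ)
    · rw [h1, h.coeff_starPoly_lead, show -((n + 1 : ℕ) : ℤ) - -1 = -(n : ℤ) by push_cast; ring,
        h.coeff_starPoly_lead, sub_self]
    · rw [h.spannedBy l n _ (by omega), h.spannedBy k (n + 1) _ (by omega), sub_self]
  · rw [h.spannedBy l n _ (by omega), h.spannedBy k (n + 1) _ (by omega), sub_self]

/-- Among the moments `k, …, k + n` only the last is not zero term by term; there the norms
`H_n^{(k-1)}` and `H_n^{(k)}` must match, which fixes `ψ`. -/
theorem geronimus (h : IsAdjacent m P Q H) (k : ℤ) (n : ℕ) :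
    T (-1) * starPoly (Q (k - 1) n) =
      starPoly (Q k (n + 1)) + starPoly (Q k n) * C (psi m k n) := by
  rw [← sub_eq_iff_eq_add', ← sub_eq_zero]
  refine ((h.spannedBy_T_mul_sub k (k - 1) n).sub ((h.spannedBy k n).mul_C _)).eq_zero
    (h.isUnit_toeplitz k n) fun i hi => ?_
  rw [map_sub, map_sub, momentFun_T_mul, momentFun_mul_C, h.momentFun_of_lt k (n + 1) i (by omega),
    sub_zero, show k + (i : ℤ) + -1 = k - 1 + i by ring]
  rcases hi.lt_or_eq with hi | rfl
  · rw [h.momentFun_of_lt _ n i hi, h.momentFun_of_lt _ n i hi, zero_mul, sub_zero]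
  · rw [h.momentFun_self, h.momentFun_self, h.psi_eq,
      mul_inv_cancel_left₀ (h.isUnit_norm k i).ne_zero, sub_self]

/-- Here only the first of the moments `k, …, k + n` survives; it lies just below both orthogonality
ranges and fixes `φ`. -/
theorem christoffel (h : IsAdjacent m P Q H) (k : ℤ) (n : ℕ) :
    starPoly (Q k (n + 1)) =
      T (-1) * starPoly (Q k n) - starPoly (Q (k + 1) n) * C (phi m k n) := by
  rw [eq_sub_iff_add_eq, ← eq_sub_iff_add_eq', eq_comm, ← sub_eq_zero]
  refine ((h.spannedBy_T_mul_sub k k n).sub ((h.spannedBy (k + 1) n).mul_C _)).eq_zero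
    (h.isUnit_toeplitz k n) fun i hi => ?_
  rw [map_sub, map_sub, momentFun_T_mul, momentFun_mul_C, h.momentFun_of_lt k (n + 1) i (by omega),
    sub_zero]
  rcases i with _ | i
  · rw [Nat.cast_zero, add_zero, h.phi_eq, mul_inv_cancel_left₀ (h.momentFun_succ_ne_zero k n),
      ← sub_eq_add_neg, sub_self]
  · rw [show k + ((i + 1 : ℕ) : ℤ) + -1 = k + i by push_cast; ring,
      show k + ((i + 1 : ℕ) : ℤ) = k + 1 + i by push_cast; ring,
      h.momentFun_of_lt _ n i (by omega), h.momentFun_of_lt _ n i (by omega), zero_mul, sub_zero]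

theorem geronimus_iff (h : IsAdjacent m P Q H) (k : ℤ) (n : ℕ) (c : R) :
    T (-1) * starPoly (Q (k - 1) n) = starPoly (Q k (n + 1)) + starPoly (Q k n) * C c ↔
      c = psi m k n := by
  refine ⟨fun hc => ?_, fun hc => hc ▸ h.geronimus k n⟩
  rw [h.geronimus, add_right_inj] at hc
  exact (mul_C_cancel (h.starPoly_ne_zero k n) hc).symm

theorem christoffel_iff (h : IsAdjacent m P Q H) (k : ℤ) (n : ℕ) (c : R) :
    starPoly (Q k (n + 1)) = T (-1) * starPoly (Q k n) - starPoly (Q (k + 1) n) * C c ↔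
      c = phi m k n := by
  refine ⟨fun hc => ?_, fun hc => hc ▸ h.christoffel k n⟩
  rw [h.christoffel, sub_right_inj] at hc
  exact (mul_C_cancel (h.starPoly_ne_zero _ n) hc).symm

/-- The Geronimus and Christoffel transformations combined. -/
theorem starPoly_pred_succ (h : IsAdjacent m P Q H) (k : ℤ) (n : ℕ) :
    starPoly (Q (k - 1) (n + 1)) =
      starPoly (Q k (n + 1)) + starPoly (Q k n) * C (psi m k n - phi m (k - 1) n) := by
  rw [h.christoffel, h.geronimus, sub_add_cancel, map_sub, mul_sub, add_sub_assoc]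

theorem T_mul_geronimus (h : IsAdjacent m P Q H) (k : ℤ) (n : ℕ) :
    T 1 * (starPoly (Q k (n + 1)) + starPoly (Q k n) * C (psi m k n)) = starPoly (Q (k - 1) n) := by
  rw [← h.geronimus, ← mul_assoc, ← T_add]
  simp

/-- Otherwise `Q_{n+1}` would agree at levels `k - 1` and `k`, and its moment `k - 1` would be zero
by orthogonality at level `k - 1`, yet non-zero as the moment just below the range at level `k`. -/
theorem psi_sub_phi_ne_zero (h : IsAdjacent m P Q H) (k : ℤ) (n : ℕ) :
    psi m k n - phi m (k - 1) n ≠ 0 := by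
  intro h0
  have h1 := h.starPoly_pred_succ k n
  rw [h0, map_zero, mul_zero, add_zero] at h1
  refine h.momentFun_pred_ne_zero k (n + 1) ?_
  have := h.momentFun_of_lt (k - 1) (n + 1) 0 (by omega)
  rwa [h1, Nat.cast_zero, add_zero] at this

end IsAdjacent

/-! ### Column-finite matrices acting on rows of Laurent polynomials -/

section Columns

open LaurentPolynomial

variable {R : Type*} [DivisionRing R]

/-- The combination `∑ rⱼ cⱼ` of a row of Laurent polynomials with a column of coefficients. -/
noncomputable def rowApply (r : ℕ → R[T;T⁻¹]) : (ℕ →₀ R) →+ R[T;T⁻¹] :=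
  Finsupp.liftAddHom fun j => (AddMonoidHom.mulLeft (r j)).comp (C : R →+* R[T;T⁻¹]).toAddMonoidHom

/-- The combination `∑ Mⱼ cⱼ` of the columns of a matrix. -/
noncomputable def colApply (M : ColMatrix R) : (ℕ →₀ R) →+ (ℕ →₀ R) :=
  Finsupp.liftAddHom fun j =>
    { toFun := fun c => (M j).mapRange (fun x => x * c) (zero_mul c)
      map_zero' := by ext; simp
      map_add' := fun a b => by ext; simp [mul_add] }

theorem rowMul_apply (r : ℕ → R[T;T⁻¹]) (M : ColMatrix R) (n : ℕ) :
    rowMul r M n = rowApply r (M n) := rfl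

theorem colMul_apply (M N : ColMatrix R) (n : ℕ) : colMul M N n = colApply M (N n) := rfl

theorem rowApply_single (r : ℕ → R[T;T⁻¹]) (j : ℕ) (c : R) :
    rowApply r (Finsupp.single j c) = r j * C c := by
  rw [rowApply, Finsupp.liftAddHom_apply_single]
  rfl

theorem colApply_single (M : ColMatrix R) (j : ℕ) (c : R) :
    colApply M (Finsupp.single j c) = (M j).mapRange (fun x => x * c) (zero_mul c) := by
  rw [colApply, Finsupp.liftAddHom_apply_single]
  rfl

theorem colApply_single_one (M : ColMatrix R) (j : ℕ) :
    colApply M (Finsupp.single j 1) = M j := by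
  rw [colApply_single]
  ext
  simp

theorem rowApply_mapRange_mul (r : ℕ → R[T;T⁻¹]) (v : ℕ →₀ R) (c : R) :
    rowApply r (v.mapRange (fun x => x * c) (zero_mul c)) = rowApply r v * C c := by
  induction v using Finsupp.induction_linear with
  | zero => simp
  | add f g hf hg =>
    rw [Finsupp.mapRange_add (fun _ _ => add_mul _ _ _), map_add, map_add, hf, hg, add_mul]
  | single j a =>
    rw [Finsupp.mapRange_single, rowApply_single, rowApply_single, map_mul, mul_assoc]

theorem rowApply_colApply (r : ℕ → R[T;T⁻¹]) (M : ColMatrix R) (v : ℕ →₀ R) :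
    rowApply r (colApply M v) = rowApply (rowMul r M) v := by
  induction v using Finsupp.induction_linear with
  | zero => simp
  | add f g hf hg => rw [map_add, map_add, map_add, hf, hg]
  | single j a => rw [colApply_single, rowApply_mapRange_mul, rowApply_single, rowMul_apply]

theorem rowMul_colMul (r : ℕ → R[T;T⁻¹]) (M N : ColMatrix R) :
    rowMul r (colMul M N) = rowMul (rowMul r M) N :=
  funext fun n => rowApply_colApply r M (N n)

theorem rowApply_T_mul (s : ℤ) (r : ℕ → R[T;T⁻¹]) (v : ℕ →₀ R) :
    rowApply (fun n => T s * r n) v = T s * rowApply r v := by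
  induction v using Finsupp.induction_linear with
  | zero => simp
  | add f g hf hg => rw [map_add, map_add, hf, hg, mul_add]
  | single j a => rw [rowApply_single, rowApply_single, mul_assoc]

theorem rowMul_T_mul (s : ℤ) (r : ℕ → R[T;T⁻¹]) (M : ColMatrix R) :
    rowMul (fun n => T s * r n) M = fun n => T s * rowMul r M n :=
  funext fun n => rowApply_T_mul s r (M n)

/-- A row of Laurent polynomials with leading terms `z⁻ⁿ` is linearly independent. -/
theorem rowApply_injective {r : ℕ → R[T;T⁻¹]} (hr : ∀ n, SpannedBy n (r n))
    (hlead : ∀ n : ℕ, (r n).coeff (-(n : ℤ)) = 1) : Function.Injective (rowApply r) := by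
  rw [injective_iff_map_eq_zero]
  intro v hv
  by_contra hne
  have hs : v.support.Nonempty := Finsupp.support_nonempty_iff.2 hne
  set N := v.support.max' hs with hN
  have hmem : N ∈ v.support := Finset.max'_mem _ _
  -- Only the term of largest index `N` reaches `z⁻ᴺ`.
  have hc : (rowApply r v).coeff (-(N : ℤ)) = v N := by
    change (v.sum fun j c => r j * C c).coeff _ = _
    rw [Finsupp.sum, AddMonoidAlgebra.coeff_sum, Finsupp.finsetSum_apply,
      Finset.sum_eq_single_of_mem N hmem]
    · rw [coeff_mul_C, hlead, one_mul]
    · intro j hj hjN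
      have : j ≤ N := Finset.le_max' _ _ hj
      rw [coeff_mul_C, hr j _ (by omega), zero_mul]
  rw [hv] at hc
  exact Finsupp.mem_support_iff.1 hmem (by simpa using hc.symm)

theorem rowMul_injective {r : ℕ → R[T;T⁻¹]} (hr : ∀ n, SpannedBy n (r n))
    (hlead : ∀ n : ℕ, (r n).coeff (-(n : ℤ)) = 1) : Function.Injective (rowMul r) :=
  fun _ _ h => funext fun n => rowApply_injective hr hlead (congrFun h n)

/-- The solution `X` of `X (I + diag(c₀, c₁, …) Λ) = Y`. -/
noncomputable def divUpper (c : ℕ → R) (Y : ColMatrix R) : ColMatrix R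
  | 0 => Y 0
  | n + 1 => Y (n + 1) - (divUpper c Y n).mapRange (fun x => x * c n) (zero_mul (c n))

theorem colMul_divUpper (c : ℕ → R) (Y : ColMatrix R) :
    colMul (divUpper c Y) (upperBidiag c) = Y := by
  funext n
  cases n with
  | zero => rw [colMul_apply, upperBidiag, colApply_single_one, divUpper]
  | succ n =>
    rw [colMul_apply, upperBidiag, map_add, colApply_single_one, colApply_single, divUpper,
      sub_add_cancel]

end Columns

/-! ### The Lax pair and the Toda equation -/

namespace IsAdjacent

open LaurentPolynomial

variable {R : Type*} [DivisionRing R] [StarRing R] {m : ℤ → R} {P Q : ℤ → ℕ → R[X]}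
  {H : ℤ → ℕ → R}

theorem rowMul_lowerBidiag (h : IsAdjacent m P Q H) (k : ℤ) :
    rowMul (fun n => starPoly (Q k n)) (lowerBidiag (psi m k)) =
      fun n => T (-1) * starPoly (Q (k - 1) n) := by
  funext n
  rw [rowMul_apply, lowerBidiag, map_add, rowApply_single, rowApply_single, h.geronimus, map_one,
    mul_one, add_comm]

theorem rowMul_upperBidiag (h : IsAdjacent m P Q H) (k : ℤ) :
    rowMul (fun n => starPoly (Q k n)) (upperBidiag fun i => psi m k i - phi m (k - 1) i) =
      fun n => starPoly (Q (k - 1) n) := by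
  funext n
  cases n with
  | zero =>
    rw [rowMul_apply, upperBidiag, rowApply_single, h.starPoly_zero, h.starPoly_zero, map_one,
      mul_one]
  | succ n =>
    rw [rowMul_apply, upperBidiag, map_add, rowApply_single, rowApply_single,
      h.starPoly_pred_succ, map_one, mul_one]

theorem rowMul_injective (h : IsAdjacent m P Q H) (k : ℤ) :
    Function.Injective (rowMul fun n => starPoly (Q k n)) :=
  NCToda.rowMul_injective (h.spannedBy k) (h.coeff_starPoly_lead k)

/-- Both `R X` and `z⁻¹ R` give `z⁻¹ R^{(k-1)}` when multiplied by the unitriangular `I + Ξ Λ`,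
which determines them column by column. -/
theorem rowMul_divUpper (h : IsAdjacent m P Q H) (k : ℤ) :
    rowMul (fun n => starPoly (Q k n))
      (divUpper (fun i => psi m k i - phi m (k - 1) i) (lowerBidiag (psi m k))) =
      fun n => T (-1) * starPoly (Q k n) := by
  funext n
  induction n with
  | zero =>
    rw [rowMul_apply, divUpper, ← rowMul_apply, h.rowMul_lowerBidiag]
    simp only [h.starPoly_zero]
  | succ n ih =>
    rw [rowMul_apply] at ih ⊢
    rw [divUpper, map_sub, rowApply_mapRange_mul, ih, ← rowMul_apply, h.rowMul_lowerBidiag]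
    simp only
    rw [h.starPoly_pred_succ, mul_add, mul_assoc, add_sub_cancel_right]

theorem discrete_lax (h : IsAdjacent m P Q H) :
    ∃ X : ℤ → ColMatrix R, ∀ k : ℤ,
      colMul (X k) (upperBidiag fun i => psi m k i - phi m (k - 1) i) = lowerBidiag (psi m k) ∧
      (fun n => T (-1) * starPoly (Q k n)) = rowMul (fun n => starPoly (Q k n)) (X k) ∧
      (fun n => T (-1) * starPoly (Q (k - 1) n)) =
        rowMul (fun n => starPoly (Q k n)) (lowerBidiag (psi m k)) ∧
      colMul (X k) (lowerBidiag (psi m k)) = colMul (lowerBidiag (psi m k)) (X (k - 1)) := by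
  refine ⟨fun k => divUpper (fun i => psi m k i - phi m (k - 1) i) (lowerBidiag (psi m k)),
    fun k => ⟨colMul_divUpper _ _, (h.rowMul_divUpper k).symm, (h.rowMul_lowerBidiag k).symm, ?_⟩⟩
  -- Both products carry `R^{(k)}` to `z⁻² R^{(k-1)}`.
  apply h.rowMul_injective k
  rw [rowMul_colMul, rowMul_colMul, h.rowMul_divUpper, h.rowMul_lowerBidiag, rowMul_T_mul,
    rowMul_T_mul, h.rowMul_lowerBidiag, h.rowMul_divUpper]

/-- Compatibility of the two factors of the Lax pair. -/
theorem lowerBidiag_mul_upperBidiag (h : IsAdjacent m P Q H) (k : ℤ) :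
    colMul (lowerBidiag (psi m (k + 1))) (upperBidiag fun i => psi m k i - phi m (k - 1) i) =
      colMul (upperBidiag fun i => psi m (k + 1) i - phi m k i) (lowerBidiag (psi m k)) := by
  -- Both products carry `R^{(k+1)}` to `z⁻¹ R^{(k-1)}`, with the shift and the change of level
  -- taken in either order.
  apply h.rowMul_injective (k + 1)
  have h1 := h.rowMul_lowerBidiag (k + 1)
  have h2 := h.rowMul_upperBidiag (k + 1)
  rw [add_sub_cancel_right] at h1 h2
  rw [rowMul_colMul, rowMul_colMul, h1, h2, rowMul_T_mul, h.rowMul_upperBidiag,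
    h.rowMul_lowerBidiag]

theorem toda_entries (h : IsAdjacent m P Q H) (k : ℤ) (i : ℕ) :
    (psi m (k + 1) i - phi m k i) * psi m k (i + 1) =
        psi m (k + 1) i * (psi m k i - phi m (k - 1) i) ∧
      psi m k (i + 1) - phi m k (i + 1) = psi m k i - phi m (k - 1) i := by
  -- In column `i + 1`, row `i` gives the multiplicative equation and row `i + 1` the additive one.
  have hc := congrFun (h.lowerBidiag_mul_upperBidiag k) (i + 1)
  rw [colMul_apply, colMul_apply, upperBidiag, lowerBidiag, map_add, map_add, colApply_single_one,
    colApply_single_one, colApply_single, colApply_single] at hc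
  have h0 := DFunLike.congr_fun hc i
  have h1 := DFunLike.congr_fun hc (i + 1)
  have hi : i + 1 + 1 ≠ i := by omega
  simp [lowerBidiag, upperBidiag, hi] at h0 h1
  refine ⟨h0.symm, ?_⟩
  grind

theorem psi_zero_eq_phi_zero (h : IsAdjacent m P Q H) (k : ℤ) : psi m k 0 = phi m k 0 := by
  have hc := congrFun (h.lowerBidiag_mul_upperBidiag k) 0
  rw [colMul_apply, colMul_apply, upperBidiag, lowerBidiag, map_add, colApply_single_one,
    colApply_single_one, colApply_single] at hc
  have h0 := DFunLike.congr_fun hc 0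
  simp [lowerBidiag, upperBidiag] at h0
  grind

/-- Substituting the additive Toda equation into the multiplicative one cancels `ψ_i^{(k+1)}
ψ_{i+1}^{(k)}`; what remains is the exchange rule that drives the leapfrog map. -/
theorem phi_mul_psi (h : IsAdjacent m P Q H) (k : ℤ) (i : ℕ) :
    phi m k i * psi m k (i + 1) = psi m (k + 1) i * phi m k (i + 1) := by
  obtain ⟨h1, h2⟩ := h.toda_entries k i
  rw [← h2, sub_mul, mul_sub] at h1
  exact sub_right_inj.1 h1

end IsAdjacent
end NCToda

/-! ### The main theorem -/

open NCToda LaurentPolynomial in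
theorem mainTheorem7 {R : Type*} [DivisionRing R] [StarRing R] (m : ℤ → R) :
    -- adjacent families exist exactly when all shifted Toeplitz matrices are invertible
    ((∀ (k : ℤ) (n : ℕ), IsUnit (toeplitz m k n)) ↔ ∃ P Q H, IsAdjacent m P Q H) ∧
    ∀ (P Q : ℤ → ℕ → Polynomial R) (H : ℤ → ℕ → R), IsAdjacent m P Q H →
      -- the quasi-determinants below are defined and invertible; the norms are among them
      (∀ (k : ℤ) (n : ℕ),
        QuasiDetDefined (toeplitz m k n) (Fin.last n) (Fin.last n) ∧
        H k n = quasiDet (toeplitz m k n) (Fin.last n) (Fin.last n) ∧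
        QuasiDetDefined (toeplitz m k n) 0 (Fin.last n) ∧
        IsUnit (quasiDet (toeplitz m k n) 0 (Fin.last n))) ∧
      -- Christoffel transformation, with its coefficient
      (∀ (k : ℤ) (n : ℕ) (c : R),
        starPoly (Q k (n + 1)) = T (-1) * starPoly (Q k n) - starPoly (Q (k + 1) n) * C c ↔
          c = phi m k n) ∧
      -- Geronimus transformation, with its coefficient
      (∀ (k : ℤ) (n : ℕ) (c : R),
        T (-1) * starPoly (Q (k - 1) n) = starPoly (Q k (n + 1)) + starPoly (Q k n) * C c ↔
          c = psi m k n) ∧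
      -- three-term recurrence; the term with index `-1` is absent for `n = 0`
      (∀ k : ℤ, T 1 * (starPoly (Q k 1) + starPoly (Q k 0) * C (psi m k 0)) =
        starPoly (Q k 0)) ∧
      (∀ (k : ℤ) (n : ℕ),
        T 1 * (starPoly (Q k (n + 2)) + starPoly (Q k (n + 1)) * C (psi m k (n + 1))) =
          starPoly (Q k (n + 1)) + starPoly (Q k n) * C (psi m k n - phi m (k - 1) n)) ∧
      -- compatibility of the recurrence with the Geronimus transformation: discrete Lax equation
      (∃ X : ℤ → ColMatrix R, ∀ k : ℤ,
        colMul (X k) (upperBidiag fun i => psi m k i - phi m (k - 1) i) =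
          lowerBidiag (psi m k) ∧
        (fun n => T (-1) * starPoly (Q k n)) = rowMul (fun n => starPoly (Q k n)) (X k) ∧
        (fun n => T (-1) * starPoly (Q (k - 1) n)) =
          rowMul (fun n => starPoly (Q k n)) (lowerBidiag (psi m k)) ∧
        colMul (X k) (lowerBidiag (psi m k)) = colMul (lowerBidiag (psi m k)) (X (k - 1))) ∧
      -- the discrete non-commutative relativistic Toda equation, with its boundary condition
      (∀ (k : ℤ) (i : ℕ),
        (psi m (k + 1) i - phi m k i) * psi m k (i + 1) =
          psi m (k + 1) i * (psi m k i - phi m (k - 1) i)) ∧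
      (∀ (k : ℤ) (i : ℕ),
        psi m k (i + 1) - phi m k (i + 1) = psi m k i - phi m (k - 1) i) ∧
      (∀ k : ℤ, psi m k 0 = phi m k 0) ∧
      -- realization of the leapfrog map, which carries level `k` to level `k - 1`
      (∀ (k : ℤ) (a b : ℤ → R),
        (∀ i : ℕ, a i = psi m k i) → (∀ i : ℕ, b i = phi m (k - 1) i - psi m k i) →
        (∀ i : ℕ, a i ≠ 0 ∧ b i ≠ 0 ∧ a i + b i ≠ 0) ∧
        (∀ i : ℕ, (leapfrogMap (a, b)).1 (i + 1) = psi m (k - 1) (i + 1)) ∧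
        (∀ i : ℕ, (leapfrogMap (a, b)).2 i = phi m (k - 2) i - psi m (k - 1) i)) := by
  refine ⟨⟨exists_isAdjacent, fun ⟨_, _, _, h⟩ => h.isUnit_toeplitz⟩, fun P Q H h =>
    ⟨fun k n => ⟨quasiDetDefined_last h.isUnit_toeplitz k n, h.eq_quasiDet_last k n,
      quasiDetDefined_zero_last h.isUnit_toeplitz k n, ?_⟩, h.christoffel_iff, h.geronimus_iff,
      fun k => ?_, fun k n => ?_, h.discrete_lax, fun k i => (h.toda_entries k i).1,
      fun k i => (h.toda_entries k i).2, h.psi_zero_eq_phi_zero, fun k a b ha hb => ?_⟩⟩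
  · rw [← h.momentFun_pred_eq_quasiDet]
    exact (h.momentFun_succ_ne_zero k n).isUnit
  · rw [h.T_mul_geronimus, h.starPoly_zero, h.starPoly_zero]
  · rw [h.T_mul_geronimus, h.starPoly_pred_succ]
  -- In the sums `a + b` the `ψ` cancels, so both components of the map reduce to the exchange rule
  -- at level `k - 1`; the second also uses the additive Toda equation.
  · have hab : ∀ i : ℕ, a i + b i = phi m (k - 1) i := fun i => by rw [ha, hb]; abel
    have hcross := h.phi_mul_psi (k - 1)
    rw [sub_add_cancel] at hcross
    refine ⟨fun i => ⟨?_, ?_, ?_⟩, fun i => ?_, fun i => ?_⟩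
    · rw [ha]
      exact h.psi_ne_zero k i
    · rw [hb, ← neg_sub]
      exact neg_ne_zero.2 (h.psi_sub_phi_ne_zero k i)
    · rw [hab]
      exact h.phi_ne_zero _ i
    · have hab' := hab (i + 1)
      push_cast at hab'
      simp only [leapfrogMap]
      rw [add_sub_cancel_right, hab, hab', ha, mul_assoc, ← hcross,
        inv_mul_cancel_left₀ (h.phi_ne_zero _ i)]
    · have hab' := hab (i + 1)
      push_cast at hab'
      have htoda := (h.toda_entries (k - 1) i).2
      rw [show k - 1 - 1 = k - 2 by ring] at htoda
      simp only [leapfrogMap]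
      rw [hab, hab', hb, mul_assoc, sub_mul, ← hcross, ← mul_sub,
        inv_mul_cancel_left₀ (h.phi_ne_zero _ i), ← neg_sub, htoda, neg_sub]
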